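/- Let $(\Omega,\mathcal F,P)$ be a probability space. For $k\ge 2$ and a probability vector $p=(p_1,\dots,p_k)$ with $p_j>0$ and $\sum_j p_j=1$, a \emph{$k$-cell multinomial sample with parameter $p$} is a sequence $X_1,X_2,\dots$ of independent random vectors in $\mathbb R^k$ on $\Omega$ with $P(X_i=e_j)=p_j$ for all $i$ and $1\le j\le k$, where $e_1,\dots,e_k$ are the unit vectors. Its count vector after $n$ trials is $N=N^{(n)}=X_1+\dots+X_n$, and its Pearson statistic is $$Q_k=\sum_{j=1}^{k}\frac{(N_j-np_j)^2}{np_j}.$$ Let $\chi^2(d)$ be the law of the sum of the squares of $d$ independent standard normal variables, and let convergence in distribution refer to $n\to\infty$. \textbf{Proposition.} (a) (Base case.) For every $2$-cell multinomial sample, $Q_2$ converges in distribution to $\chi^2(1)$. (b) (Induction step.) Let $k\ge2$. If $Q_k$ converges in distribution to $\chi^2(k-1)$ for every probability vector with positive entries and every $k$-cell multinomial sample with that parameter, then $Q_{k+1}$ converges in distribution to $\chi^2(k)$ for every probability vector with positive entries and every $(k+1)$-cell multinomial sample with that parameter. (c) (Merging the last two cells.) Let $k\ge 2$ and let $(X_i)$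 be a $(k+1)$-cell multinomial sample with parameter $p$ and counts $N$. Put $p'=(p_1,\dots,p_{k-1},p_k+p_{k+1})$ and $N'=(N_1,\dots,N_{k-1},N_k+N_{k+1})$. Adding the last two coordinates of every $X_i$ gives a $k$-cell multinomial sample with parameter $p'$ and counts $N'$. Let $Q'_k$ be its Pearson statistic and let $$V=\frac{p_{k+1}N_k-p_kN_{k+1}}{\sqrt{n\,p_k\,p_{k+1}\,(p_k+p_{k+1})}}.$$ Then for every $n\ge1$ one has $Q_{k+1}=Q'_k+V^2$; the variables $V,N'_1,\dots,N'_k$ are square integrable, and $\operatorname{Cov}(V,N'_j)=0$ for all $1\le j\le k$; and $V$ converges in distribution to $N(0,1)$ as $n\to\infty$. -/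

import Mathlib

open MeasureTheory ProbabilityTheory Filter

noncomputable section

/-- The chi-square distribution with `d` degrees of freedom: the law of `Z₁² + ⋯ + Z_d²` for
independent standard normal variables `Z₁, …, Z_d`. -/
def chiSquare (d : ℕ) : Measure ℝ :=
  (Measure.pi fun _ : Fin d => gaussianReal 0 1).map fun z => ∑ i, z i ^ 2

instance isProbabilityMeasure_chiSquare (d : ℕ) : IsProbabilityMeasure (chiSquare d) :=
  Measure.isProbabilityMeasure_map (Measurable.aemeasurable (by fun_prop))

/-- `X 0, X 1, …` are independent multinomial(1, `p`) random vectors on `(Ω, P)`, for a probability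
vector `p` with `k` positive entries: each `X i` equals the `j`-th unit vector with probability
`p j`. -/
structure IsMultinomialSample {Ω : Type*} [MeasurableSpace Ω] (P : Measure Ω) {k : ℕ}
    (p : Fin k → ℝ) (X : ℕ → Ω → Fin k → ℝ) : Prop where
  pos : ∀ j, 0 < p j
  sum_eq_one : ∑ j, p j = 1
  measurable : ∀ i, Measurable (X i)
  indep : iIndepFun X P
  law : ∀ i j, P.real {ω | X i ω = Pi.single j 1} = p j

/-- The vector of counts `N = (N₁, …, N_k)` after the first `n` trials. -/
def counts {Ω : Type*} {k : ℕ} (X : ℕ → Ω → Fin k → ℝ) (n : ℕ) (ω : Ω) (j : Fin k) : ℝ :=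
  ∑ i ∈ Finset.range n, X i ω j

/-- The Pearson statistic `∑ j, (N j - n p j)² / (n p j)`. -/
def pearsonStat {k : ℕ} (p : Fin k → ℝ) (n : ℕ) (N : Fin k → ℝ) : ℝ :=
  ∑ j, (N j - n * p j) ^ 2 / (n * p j)

/-- On `(Ω, P)`, the `k`-cell Pearson statistic converges in distribution, as the number of trials
tends to infinity, to the chi-square distribution with `k - 1` degrees of freedom, whatever the
probability vector and the sample. -/
def PearsonConverges {Ω : Type*} [MeasurableSpace Ω] (P : Measure Ω) [IsProbabilityMeasure P]
    (k : ℕ) : Prop :=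
  ∀ (p : Fin k → ℝ) (X : ℕ → Ω → Fin k → ℝ), IsMultinomialSample P p X →
    TendstoInDistribution (fun (n : ℕ) (ω : Ω) => pearsonStat p n (counts X n ω)) atTop
      (id : ℝ → ℝ) (fun _ => P) (chiSquare (k - 1))

/-- Merging the last two of `k + 1` cells:
`(x₁, …, x_{k+1}) ↦ (x₁, …, x_{k-1}, x_k + x_{k+1})`. -/
def mergeLastTwo {k : ℕ} (x : Fin (k + 1) → ℝ) (j : Fin k) : ℝ :=
  if (j : ℕ) + 1 = k then x j.castSucc + x (Fin.last k) else x j.castSucc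

/-- The last but one of `k + 1` cells (used for `1 ≤ k`). -/
def lastButOne (k : ℕ) : Fin (k + 1) := ⟨k - 1, by omega⟩

/-- `V = (p_{k+1} N_k - p_k N_{k+1}) / √(n p_k p_{k+1} (p_k + p_{k+1}))`. -/
def splitContrast {k : ℕ} (p : Fin (k + 1) → ℝ) (n : ℕ) (N : Fin (k + 1) → ℝ) : ℝ :=
  (p (Fin.last k) * N (lastButOne k) - p (lastButOne k) * N (Fin.last k)) /
    Real.sqrt (n * p (lastButOne k) * p (Fin.last k) * (p (lastButOne k) + p (Fin.last k)))

end

/-!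
Pearson's theorem is proved geometrically, for every number of cells at once (`pearsonConverges`);
this contains the base case and gives the conclusion of the induction step directly.

Divide the `j`-th coordinate of a trial by `√p_j`. The count vector adds up to `n` almost surely, so
after this scaling its deviation from the expected counts is orthogonal to the unit vector
`u = (√p₁, …, √p_k)`, and the Pearson statistic is the squared norm of the projection of the scaled
and normalized counts to the hyperplane `uᗮ` (`pearsonStat_eq`). For `t ∈ uᗮ` a projected scaled
trial has mean `∑ j, √p_j t_j = 0` and second moment `∑ j, p_j (t_j / √p_j)² = ‖t‖²` in the direction
`t`. By the central limit theorem in `uᗮ`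
(`tendstoInDistribution_inv_sqrt_smul_sum_stdGaussian`) the normalized sum tends to the standard
Gaussian vector of that `(k - 1)`-dimensional space, whose squared norm has the law `χ²(k - 1)`
(`map_norm_sq_stdGaussian`).

For the merging of the last two cells, the decomposition is an algebraic identity in the two
deviations (`pearsonStat_eq_add_splitContrast_sq`). The contrast `V` is `1 / √n` times a sum of
independent trial contrasts, of mean `0` and variance `1`, so it is asymptotically normal by the
one-dimensional central limit theorem. A trial contrast is orthogonal to every function that takes
the same value on the last two cells (`IsMultinomialSample.integral_trialContrast_mul`), hence `V` is
uncorrelated with the merged counts.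
-/

/-! ### Trials -/

lemma single_one_inj {k : ℕ} {l j : Fin k} :
    (Pi.single l 1 : Fin k → ℝ) = Pi.single j 1 ↔ l = j := by
  refine ⟨fun h => ?_, fun h => h ▸ rfl⟩
  by_contra hne
  simpa [Pi.single_eq_of_ne hne] using congrFun h l

namespace IsMultinomialSample

variable {Ω : Type*} [MeasurableSpace Ω] {P : Measure Ω} [IsProbabilityMeasure P] {k : ℕ}
  {p : Fin k → ℝ} {X : ℕ → Ω → Fin k → ℝ}

lemma ae_exists_eq_single (h : IsMultinomialSample P p X) (i : ℕ) :
    ∀ᵐ ω ∂P, ∃ j, X i ω = Pi.single j 1 := by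
  have hmeas (j : Fin k) : MeasurableSet {ω | X i ω = Pi.single j 1} :=
    h.measurable i (measurableSet_singleton _)
  have hdisj : Pairwise (Function.onFun Disjoint fun j : Fin k => {ω | X i ω = Pi.single j 1}) := by
    intro j l hjl
    exact Set.disjoint_left.2 fun ω hj hl => hjl (single_one_inj.1 ((Eq.symm hj).trans hl))
  have hU : P.real (⋃ j, {ω | X i ω = Pi.single j 1}) = 1 := by
    rw [measureReal_iUnion_fintype hdisj hmeas]
    simp_rw [h.law, h.sum_eq_one]
  have hU' : P (⋃ j, {ω | X i ω = Pi.single j 1}) = 1 := by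
    rwa [measureReal_def, ENNReal.toReal_eq_one_iff] at hU
  filter_upwards [(mem_ae_iff_prob_eq_one (MeasurableSet.iUnion hmeas)).2 hU'] with ω hω
  simpa using hω

/-- Trials are discrete: the expectation of any function of a trial is a finite sum. -/
lemma integral_comp (h : IsMultinomialSample P p X) (i : ℕ) (f : (Fin k → ℝ) → ℝ) :
    ∫ ω, f (X i ω) ∂P = ∑ j, p j * f (Pi.single j 1) := by
  have hmeas (j : Fin k) : MeasurableSet {ω | X i ω = Pi.single j 1} :=
    h.measurable i (measurableSet_singleton _)
  have hf : (fun ω => f (X i ω)) =ᵐ[P] fun ω =>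
      ∑ j, {ω | X i ω = Pi.single j 1}.indicator (fun _ => f (Pi.single j 1)) ω := by
    filter_upwards [h.ae_exists_eq_single i] with ω ⟨j, hj⟩
    rw [Finset.sum_eq_single j]
    · simp [hj]
    · intro l _ hl
      exact Set.indicator_of_notMem
        (fun hmem => hl (single_one_inj.1 ((Eq.symm hmem).trans hj))) _
    · simp
  rw [integral_congr_ae hf, integral_finsetSum _ fun j _ =>
    (integrable_const (f (Pi.single j 1))).indicator (hmeas j)]
  refine Finset.sum_congr rfl fun j _ => ?_
  rw [integral_indicator_const _ (hmeas j), h.law, smul_eq_mul]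

lemma measureReal_preimage (h : IsMultinomialSample P p X) (i : ℕ) {B : Set (Fin k → ℝ)}
    (hB : MeasurableSet B) :
    P.real (X i ⁻¹' B) = ∑ j, p j * B.indicator (fun _ => 1) (Pi.single j 1) := by
  rw [← h.integral_comp i, ← integral_indicator_one (h.measurable i hB)]
  rfl

lemma identDistrib (h : IsMultinomialSample P p X) (i : ℕ) : IdentDistrib (X i) (X 0) P P where
  aemeasurable_fst := (h.measurable i).aemeasurable
  aemeasurable_snd := (h.measurable 0).aemeasurable
  map_eq := by
    ext B hB
    rw [Measure.map_apply (h.measurable i) hB, Measure.map_apply (h.measurable 0) hB,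
      ← measureReal_eq_measureReal_iff, h.measureReal_preimage i hB, h.measureReal_preimage 0 hB]

lemma memLp_comp (h : IsMultinomialSample P p X) (i : ℕ) {f : (Fin k → ℝ) → ℝ}
    (hf : Measurable f) : MemLp (fun ω => f (X i ω)) 2 P := by
  refine MemLp.of_bound (hf.comp (h.measurable i)).aestronglyMeasurable
    (∑ j, ‖f (Pi.single j 1)‖) ?_
  filter_upwards [h.ae_exists_eq_single i] with ω ⟨j, hj⟩
  rw [hj]
  exact Finset.single_le_sum (f := fun j => ‖f (Pi.single j 1)‖) (fun _ _ => norm_nonneg _)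
    (Finset.mem_univ j)

lemma memLp_counts (h : IsMultinomialSample P p X) (n : ℕ) (j : Fin k) :
    MemLp (fun ω => counts X n ω j) 2 P :=
  memLp_finsetSum _ fun i _ => h.memLp_comp i (f := fun x => x j) (by fun_prop)

lemma ae_sum_counts (h : IsMultinomialSample P p X) (n : ℕ) :
    ∀ᵐ ω ∂P, ∑ j, counts X n ω j = n := by
  filter_upwards [ae_all_iff.2 h.ae_exists_eq_single] with ω hω
  unfold counts
  rw [Finset.sum_comm]
  have (i : ℕ) : ∑ j, X i ω j = 1 := by
    obtain ⟨j, hj⟩ := hω i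
    simp [hj]
  simp [this]

end IsMultinomialSample

/-! ### The central limit theorem in Euclidean spaces -/

/-- The **multivariate central limit theorem** for trials whose covariance form is the inner product.
By Lévy's continuity theorem it suffices to apply the one-dimensional theorem to each linear
functional `⟪·, t⟫`. -/
theorem tendstoInDistribution_inv_sqrt_smul_sum_stdGaussian {Ω E : Type*} [MeasurableSpace Ω]
    {P : Measure Ω} [IsProbabilityMeasure P] [NormedAddCommGroup E] [InnerProductSpace ℝ E]
    [FiniteDimensional ℝ E] [MeasurableSpace E] [BorelSpace E] {Z : ℕ → Ω → E}
    (hZ : ∀ i, Measurable (Z i)) (hindep : iIndepFun Z P)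
    (hident : ∀ i, IdentDistrib (Z i) (Z 0) P P)
    (hL2 : ∀ t, MemLp (fun ω => inner ℝ (Z 0 ω) t) 2 P)
    (hmean : ∀ t, ∫ ω, inner ℝ (Z 0 ω) t ∂P = 0)
    (hvar : ∀ t, ∫ ω, inner ℝ (Z 0 ω) t ^ 2 ∂P = ‖t‖ ^ 2) :
    TendstoInDistribution
      (fun (n : ℕ) ω => (√(n : ℝ))⁻¹ • ∑ i ∈ Finset.range n, Z i ω) atTop
      (id : E → E) (fun _ => P) (stdGaussian E) where
  forall_aemeasurable n := Measurable.aemeasurable (by fun_prop)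
  tendsto := by
    refine ProbabilityMeasure.tendsto_iff_tendsto_charFun.2 fun t => ?_
    have hu : Measurable fun z : E => inner ℝ z t := by fun_prop
    have hVar : Var[fun ω => inner ℝ (Z 0 ω) t; P] = ‖t‖ ^ 2 := by
      rw [variance_of_integral_eq_zero (Measurable.aemeasurable (by fun_prop)) (hmean t), hvar]
    have hclt := tendstoInDistribution_inv_sqrt_mul_sum_sub (P := P)
      (X := fun i ω => inner ℝ (Z i ω) t) (HasLaw.id (μ := gaussianReal 0 _)) (hL2 t)
      (hindep.comp (fun _ z => inner ℝ z t) fun _ => hu) fun i => (hident i).comp hu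
    have h1 := ProbabilityMeasure.tendsto_iff_tendsto_charFun.1 hclt.tendsto 1
    simp only [ProbabilityMeasure.coe_mk, Measure.map_id, charFun_gaussianReal, hVar,
      hmean] at h1 ⊢
    rw [charFun_stdGaussian]
    convert! h1 using 2 with n
    · rw [charFun_apply, charFun_apply,
        integral_map (Measurable.aemeasurable (by fun_prop)) (by fun_prop),
        integral_map (Measurable.aemeasurable (by fun_prop)) (by fun_prop)]
      simp [real_inner_smul_left, sum_inner]
    · simp [neg_div]

/-! ### The Pearson statistic as a squared norm -/

/-- In the coordinates of an orthonormal basis, a standard Gaussian vector has independent standard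
normal entries, and its squared norm is the sum of their squares. -/
lemma map_norm_sq_stdGaussian {E : Type*} [NormedAddCommGroup E] [InnerProductSpace ℝ E]
    [FiniteDimensional ℝ E] [MeasurableSpace E] [BorelSpace E] {d : ℕ}
    (hd : Module.finrank ℝ E = d) :
    (stdGaussian E).map (fun x => ‖x‖ ^ 2) = chiSquare d := by
  let b : OrthonormalBasis (Fin d) ℝ E := (stdOrthonormalBasis ℝ E).reindex (finCongr hd)
  rw [stdGaussian_eq_map_pi_orthonormalBasis b, Measure.map_map (by fun_prop) (by fun_prop),
    chiSquare]
  congr 1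
  ext z
  rw [Function.comp_apply, ← real_inner_self_eq_norm_sq, b.orthonormal.inner_sum]
  simp [sq]

/-- The unit vector `(√p₁, …, √p_k)`. -/
noncomputable def sqrtVec {k : ℕ} (p : Fin k → ℝ) : EuclideanSpace ℝ (Fin k) :=
  WithLp.toLp 2 fun j => √(p j)

/-- The vector `(x₁ / √p₁, …, x_k / √p_k)`, projected to the orthogonal complement of
`(√p₁, …, √p_k)`. It depends on `x` only through `x - c p`, for every scalar `c`, so no centring is
needed: projecting the scaled counts is the same as projecting their scaled deviations. -/
noncomputable def projScaled {k : ℕ} (p x : Fin k → ℝ) : (ℝ ∙ sqrtVec p)ᗮ :=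
  (ℝ ∙ sqrtVec p)ᗮ.orthogonalProjectionOnto (WithLp.toLp 2 fun j => x j / √(p j))

lemma measurable_projScaled {k : ℕ} (p : Fin k → ℝ) : Measurable (projScaled p) := by
  unfold projScaled
  fun_prop

lemma sum_projScaled {k : ℕ} (p : Fin k → ℝ) {ι : Type*} (s : Finset ι) (x : ι → Fin k → ℝ) :
    ∑ i ∈ s, projScaled p (x i) = projScaled p fun j => ∑ i ∈ s, x i j := by
  simp only [projScaled, ← map_sum]
  congr 1
  ext j
  simp [Finset.sum_div]

lemma inner_projScaled {k : ℕ} (p x : Fin k → ℝ) (t : (ℝ ∙ sqrtVec p)ᗮ) :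
    inner ℝ (projScaled p x) t = ∑ j, x j / √(p j) * (t : EuclideanSpace ℝ (Fin k)) j := by
  rw [projScaled, Submodule.inner_orthogonalProjectionOnto_eq_of_mem_right]
  simp [PiLp.inner_apply, mul_comm]

/-- `t` is orthogonal to `(√p₁, …, √p_k)`. -/
lemma sum_sqrt_mul_eq_zero {k : ℕ} (p : Fin k → ℝ) (t : (ℝ ∙ sqrtVec p)ᗮ) :
    ∑ j, √(p j) * (t : EuclideanSpace ℝ (Fin k)) j = 0 := by
  have := Submodule.mem_orthogonal_singleton_iff_inner_right.1 t.2
  simpa [PiLp.inner_apply, sqrtVec, mul_comm] using this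

lemma norm_sqrtVec_sq {k : ℕ} {p : Fin k → ℝ} (hp : ∀ j, 0 < p j) (hsum : ∑ j, p j = 1) :
    ‖sqrtVec p‖ ^ 2 = 1 := by
  simp [EuclideanSpace.norm_sq_eq, sqrtVec, Real.sq_sqrt (hp _).le, hsum]

lemma norm_projScaled_sq {k : ℕ} {p : Fin k → ℝ} (hp : ∀ j, 0 < p j) (hsum : ∑ j, p j = 1)
    (x : Fin k → ℝ) :
    ‖projScaled p x‖ ^ 2 = ∑ j, x j ^ 2 / p j - (∑ j, x j) ^ 2 := by
  set w : EuclideanSpace ℝ (Fin k) := WithLp.toLp 2 fun j => x j / √(p j) with hw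
  have hu : ‖sqrtVec p‖ = 1 :=
    (pow_eq_one_iff_of_nonneg (norm_nonneg _) two_ne_zero).1 (norm_sqrtVec_sq hp hsum)
  have hpyth := Submodule.norm_sq_eq_add_norm_sq_projection w (ℝ ∙ sqrtVec p)
  have hin : inner ℝ (sqrtVec p) w = ∑ j, x j := by
    simp only [PiLp.inner_apply, sqrtVec, hw]
    refine Finset.sum_congr rfl fun j _ => ?_
    have := (Real.sqrt_pos.2 (hp j)).ne'
    simp [this]
  have hproj : ‖(ℝ ∙ sqrtVec p).orthogonalProjectionOnto w‖ ^ 2 = (∑ j, x j) ^ 2 := by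
    rw [Submodule.coe_norm, Submodule.coe_orthogonalProjectionOnto_apply,
      Submodule.starProjection_unit_singleton ℝ hu, norm_smul, hin, hu]
    simp
  have hwn : ‖w‖ ^ 2 = ∑ j, x j ^ 2 / p j := by
    simp [EuclideanSpace.norm_sq_eq, hw, div_pow, Real.sq_sqrt (hp _).le]
  rw [hproj, hwn] at hpyth
  rw [projScaled, hpyth]
  ring

/-- For counts that add up to `n`, the scaled deviations `(N j - n p j) / √(n p j)` are orthogonal to
`(√p₁, …, √p_k)`, so the projection keeps their squared norm, the Pearson statistic. -/
lemma pearsonStat_eq {k : ℕ} {p : Fin k → ℝ} (hp : ∀ j, 0 < p j) (hsum : ∑ j, p j = 1)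
    {n : ℕ} {N : Fin k → ℝ} (hN : ∑ j, N j = n) :
    pearsonStat p n N = ‖(√(n : ℝ))⁻¹ • projScaled p N‖ ^ 2 := by
  rw [norm_smul, mul_pow, norm_projScaled_sq hp hsum, hN]
  -- for `n = 0` both sides are `0`, by division by zero
  rcases Nat.eq_zero_or_pos n with rfl | hn
  · simp [pearsonStat]
  have hn' : (0 : ℝ) < n := by exact_mod_cast hn
  have hterm (j : Fin k) : (N j - n * p j) ^ 2 / (n * p j)
      = (n : ℝ)⁻¹ * (N j ^ 2 / p j) - 2 * N j + n * p j := by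
    have := (hp j).ne'
    field_simp
    ring
  simp only [pearsonStat, hterm, Finset.sum_add_distrib, Finset.sum_sub_distrib, ← Finset.mul_sum,
    hN, hsum]
  rw [norm_inv, inv_pow, Real.norm_of_nonneg (Real.sqrt_nonneg _), Real.sq_sqrt hn'.le]
  field_simp
  ring

/-- **Pearson's theorem**, for any number of cells. The covariance form of the projected scaled
trials is the inner product of the orthogonal complement of `(√p₁, …, √p_k)`, a space of dimension
`k - 1`, so their normalized sums tend to a standard Gaussian vector there. -/
theorem pearsonConverges {Ω : Type*} [MeasurableSpace Ω] (P : Measure Ω) [IsProbabilityMeasure P]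
    (k : ℕ) : PearsonConverges P k := by
  intro p X h
  have hmeas := measurable_projScaled p
  have hpos := h.pos
  have hclt := tendstoInDistribution_inv_sqrt_smul_sum_stdGaussian (P := P)
    (Z := fun i ω => projScaled p (X i ω)) (fun i => hmeas.comp (h.measurable i))
    (h.indep.comp (fun _ => projScaled p) fun _ => hmeas) (fun i => (h.identDistrib i).comp hmeas)
    (fun t => h.memLp_comp 0 (f := fun x => inner ℝ (projScaled p x) t) (by fun_prop))
    -- the mean in the direction `t` is `⟪t, (√p₁, …, √p_k)⟫`
    (fun t => by
      rw [h.integral_comp 0 fun x => inner ℝ (projScaled p x) t, ← sum_sqrt_mul_eq_zero p t]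
      refine Finset.sum_congr rfl fun j _ => ?_
      rw [inner_projScaled, Finset.sum_eq_single j (by simp +contextual) (by simp)]
      simp only [Pi.single_eq_same]
      rw [← mul_assoc, mul_one_div, Real.div_sqrt])
    -- the second moment in the direction `t` is `∑ j, p j * (t j / √(p j)) ^ 2`
    (fun t => by
      rw [h.integral_comp 0 fun x => inner ℝ (projScaled p x) t ^ 2, Submodule.coe_norm,
        EuclideanSpace.norm_sq_eq]
      refine Finset.sum_congr rfl fun j _ => ?_
      rw [inner_projScaled, Finset.sum_eq_single j (by simp +contextual) (by simp)]
      have := (hpos j).ne'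
      simp only [Pi.single_eq_same, mul_pow, div_pow, Real.sq_sqrt (hpos j).le, Real.norm_eq_abs,
        sq_abs]
      field_simp)
  have hnorm := hclt.continuous_comp (g := fun z => ‖z‖ ^ 2) (by fun_prop)
  have hu : sqrtVec p ≠ 0 := fun h0 => by
    have := norm_sqrtVec_sq hpos h.sum_eq_one
    simp [h0] at this
  have hrank : Module.finrank ℝ (ℝ ∙ sqrtVec p)ᗮ = k - 1 := by
    have h1 := Submodule.finrank_add_finrank_orthogonal (ℝ ∙ sqrtVec p)
    rw [finrank_span_singleton hu, finrank_euclideanSpace_fin] at h1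
    omega
  have hstat := hnorm.congr (Y := fun n ω => pearsonStat p n (counts X n ω)) (fun n => by
    filter_upwards [h.ae_sum_counts n] with ω hω
    rw [pearsonStat_eq hpos h.sum_eq_one hω]
    simp only [Function.comp_apply, sum_projScaled]
    rfl) ae_eq_rfl
  refine ⟨hstat.forall_aemeasurable, aemeasurable_id, ?_⟩
  convert! hstat.tendsto using 2
  simp [← map_norm_sq_stdGaussian hrank]

/-! ### Merging the last two cells -/

lemma mergeLastTwo_castSucc {m : ℕ} (x : Fin (m + 2) → ℝ) (i : Fin m) :
    mergeLastTwo x i.castSucc = x i.castSucc.castSucc := by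
  have := i.2.ne
  simp [mergeLastTwo, this]

lemma mergeLastTwo_last {m : ℕ} (x : Fin (m + 2) → ℝ) :
    mergeLastTwo x (Fin.last m) = x (Fin.last m).castSucc + x (Fin.last (m + 1)) := by
  simp [mergeLastTwo]

lemma lastButOne_succ (m : ℕ) : lastButOne (m + 1) = (Fin.last m).castSucc := rfl

lemma measurable_mergeLastTwo {k : ℕ} : Measurable (mergeLastTwo (k := k)) := by
  refine measurable_pi_lambda _ fun j => ?_
  unfold mergeLastTwo
  split_ifs <;> fun_prop

lemma mergeLastTwo_single_castSucc {m : ℕ} (l : Fin (m + 1)) :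
    mergeLastTwo (Pi.single l.castSucc 1) = Pi.single l 1 := by
  ext j
  cases j using Fin.lastCases with
  | last => simp [mergeLastTwo_last, Pi.single_apply]
  | cast i => simp [mergeLastTwo_castSucc, Pi.single_apply]

lemma mergeLastTwo_single_last (m : ℕ) :
    mergeLastTwo (Pi.single (Fin.last (m + 1)) 1) = Pi.single (Fin.last m) 1 := by
  ext j
  cases j using Fin.lastCases with
  | last => simp [mergeLastTwo_last]
  | cast i => simp [mergeLastTwo_castSucc]

lemma counts_mergeLastTwo {Ω : Type*} {k : ℕ} (X : ℕ → Ω → Fin (k + 1) → ℝ) (n : ℕ) (ω : Ω) :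
    counts (fun i ω => mergeLastTwo (X i ω)) n ω = mergeLastTwo (counts X n ω) := by
  ext j
  unfold counts mergeLastTwo
  split_ifs <;> simp [*, Finset.sum_add_distrib]

lemma IsMultinomialSample.merge {Ω : Type*} [MeasurableSpace Ω] {P : Measure Ω}
    [IsProbabilityMeasure P] {m : ℕ} {p : Fin (m + 2) → ℝ} {X : ℕ → Ω → Fin (m + 2) → ℝ}
    (h : IsMultinomialSample P p X) :
    IsMultinomialSample P (mergeLastTwo p) (fun i ω => mergeLastTwo (X i ω)) where
  pos j := by
    cases j using Fin.lastCases with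
    | last => rw [mergeLastTwo_last]; exact add_pos (h.pos _) (h.pos _)
    | cast i => rw [mergeLastTwo_castSucc]; exact h.pos _
  sum_eq_one := by
    rw [Fin.sum_univ_castSucc, ← h.sum_eq_one, Fin.sum_univ_castSucc, Fin.sum_univ_castSucc]
    simp only [mergeLastTwo_castSucc, mergeLastTwo_last, add_assoc]
  measurable i := measurable_mergeLastTwo.comp (h.measurable i)
  indep := h.indep.comp (fun _ => mergeLastTwo) fun _ => measurable_mergeLastTwo
  law i j := by
    have hB : MeasurableSet {x : Fin (m + 2) → ℝ | mergeLastTwo x = Pi.single j 1} :=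
      measurable_mergeLastTwo (measurableSet_singleton _)
    have hset := h.measureReal_preimage i hB
    rw [Set.preimage_ofPred_eq] at hset
    rw [hset, Fin.sum_univ_castSucc]
    simp only [Set.indicator_apply, Set.mem_ofPred_eq, mergeLastTwo_single_castSucc,
      mergeLastTwo_single_last, single_one_inj]
    cases j using Fin.lastCases with
    | last => simp [mergeLastTwo_last]
    | cast i => simp [mergeLastTwo_castSucc, (Fin.castSucc_ne_last _).symm]

/-! ### The contrast between the last two cells -/

/-- Splitting a merged cell adds the square of the contrast: with deviations `x`, `y` from the
expected counts, `x²/a + y²/b = (x + y)²/(a + b) + (b x - a y)²/(a b (a + b))`. -/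
lemma pearsonStat_eq_add_splitContrast_sq {m : ℕ} {p : Fin (m + 2) → ℝ} (hp : ∀ j, 0 < p j)
    {n : ℕ} (hn : 1 ≤ n) (N : Fin (m + 2) → ℝ) :
    pearsonStat p n N = pearsonStat (mergeLastTwo p) n (mergeLastTwo N) +
      splitContrast p n N ^ 2 := by
  have hn' : (0 : ℝ) < n := by exact_mod_cast hn
  have ha := hp (Fin.last m).castSucc
  have hb := hp (Fin.last (m + 1))
  unfold pearsonStat splitContrast
  rw [Fin.sum_univ_castSucc, Fin.sum_univ_castSucc, Fin.sum_univ_castSucc]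
  simp only [mergeLastTwo_castSucc, mergeLastTwo_last, lastButOne_succ]
  rw [div_pow, Real.sq_sqrt (by positivity), add_assoc, add_assoc]
  congr 1
  field_simp
  ring

/-- The contribution of one trial `x` to `√n` times the contrast: `(b x_{m+1} - a x_{m+2})` over
`√(a b (a + b))`, where `a` and `b` are the probabilities of the last two of the `m + 2` cells. -/
noncomputable def trialContrast {m : ℕ} (p x : Fin (m + 2) → ℝ) : ℝ :=
  (p (Fin.last (m + 1)) * x (Fin.last m).castSucc -
      p (Fin.last m).castSucc * x (Fin.last (m + 1))) /
    √(p (Fin.last m).castSucc * p (Fin.last (m + 1)) *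
      (p (Fin.last m).castSucc + p (Fin.last (m + 1))))

lemma measurable_trialContrast {m : ℕ} (p : Fin (m + 2) → ℝ) : Measurable (trialContrast p) := by
  unfold trialContrast
  fun_prop

lemma splitContrast_counts {Ω : Type*} {m : ℕ} (p : Fin (m + 2) → ℝ)
    (X : ℕ → Ω → Fin (m + 2) → ℝ) (n : ℕ) (ω : Ω) :
    splitContrast p n (counts X n ω) =
      (√(n : ℝ))⁻¹ * ∑ i ∈ Finset.range n, trialContrast p (X i ω) := by
  simp only [splitContrast, trialContrast, counts, lastButOne_succ, ← Finset.sum_div,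
    Finset.sum_sub_distrib, ← Finset.mul_sum]
  rw [mul_assoc, mul_assoc, Real.sqrt_mul n.cast_nonneg, ← mul_assoc]
  ring

section Contrast

variable {Ω : Type*} [MeasurableSpace Ω] {P : Measure Ω} [IsProbabilityMeasure P] {m : ℕ}
  {p : Fin (m + 2) → ℝ} {X : ℕ → Ω → Fin (m + 2) → ℝ}

lemma trialContrast_single_castSucc_castSucc (i : Fin m) :
    trialContrast p (Pi.single i.castSucc.castSucc 1) = 0 := by
  simp [trialContrast, (Fin.castSucc_ne_last _).symm]

lemma trialContrast_single_castSucc_last :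
    trialContrast p (Pi.single (Fin.last m).castSucc 1) = p (Fin.last (m + 1)) /
    √(p (Fin.last m).castSucc * p (Fin.last (m + 1)) *
      (p (Fin.last m).castSucc + p (Fin.last (m + 1)))) := by
  simp [trialContrast, (Fin.castSucc_ne_last _).symm]

lemma trialContrast_single_last :
    trialContrast p (Pi.single (Fin.last (m + 1)) 1) = -p (Fin.last m).castSucc /
    √(p (Fin.last m).castSucc * p (Fin.last (m + 1)) *
      (p (Fin.last m).castSucc + p (Fin.last (m + 1)))) := by
  simp [trialContrast, Fin.castSucc_ne_last]

/-- A trial contrast is orthogonal to every function that does not distinguish the last two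
cells. -/
lemma IsMultinomialSample.integral_trialContrast_mul (h : IsMultinomialSample P p X) (i : ℕ)
    {f : (Fin (m + 2) → ℝ) → ℝ}
    (hf : f (Pi.single (Fin.last m).castSucc 1) = f (Pi.single (Fin.last (m + 1)) 1)) :
    ∫ ω, trialContrast p (X i ω) * f (X i ω) ∂P = 0 := by
  rw [h.integral_comp i fun x => trialContrast p x * f x, Fin.sum_univ_castSucc,
    Fin.sum_univ_castSucc, trialContrast_single_castSucc_last, trialContrast_single_last, hf]
  simp only [trialContrast_single_castSucc_castSucc]
  simp
  ring

lemma IsMultinomialSample.integral_trialContrast (h : IsMultinomialSample P p X) (i : ℕ) :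
    ∫ ω, trialContrast p (X i ω) ∂P = 0 := by
  simpa using h.integral_trialContrast_mul i (f := fun _ => 1) rfl

lemma IsMultinomialSample.integral_trialContrast_sq (h : IsMultinomialSample P p X) (i : ℕ) :
    ∫ ω, trialContrast p (X i ω) ^ 2 ∂P = 1 := by
  have ha := h.pos (Fin.last m).castSucc
  have hb := h.pos (Fin.last (m + 1))
  rw [h.integral_comp i fun x => trialContrast p x ^ 2, Fin.sum_univ_castSucc,
    Fin.sum_univ_castSucc, trialContrast_single_castSucc_last, trialContrast_single_last]
  simp only [trialContrast_single_castSucc_castSucc, div_pow]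
  rw [Real.sq_sqrt (by positivity)]
  simp
  field_simp
  ring

lemma IsMultinomialSample.tendstoInDistribution_splitContrast (h : IsMultinomialSample P p X) :
    TendstoInDistribution (fun (n : ℕ) (ω : Ω) => splitContrast p n (counts X n ω)) atTop
      (id : ℝ → ℝ) (fun _ => P) (gaussianReal 0 1) := by
  simp only [splitContrast_counts]
  exact tendstoInDistribution_inv_sqrt_mul_sum (X := fun i ω => trialContrast p (X i ω)) HasLaw.id
    (h.integral_trialContrast 0) (h.integral_trialContrast_sq 0)
    (h.indep.comp (fun _ => trialContrast p) fun _ => measurable_trialContrast p)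
    fun i => (h.identDistrib i).comp (measurable_trialContrast p)

lemma IsMultinomialSample.memLp_splitContrast (h : IsMultinomialSample P p X) (n : ℕ) :
    MemLp (fun ω => splitContrast p n (counts X n ω)) 2 P := by
  simp only [splitContrast_counts]
  exact (memLp_finsetSum _ fun i _ => h.memLp_comp i (measurable_trialContrast p)).const_mul _

lemma IsMultinomialSample.covariance_splitContrast (h : IsMultinomialSample P p X) (n : ℕ)
    (j : Fin (m + 1)) :
    cov[fun ω => splitContrast p n (counts X n ω),
      fun ω => mergeLastTwo (counts X n ω) j; P] = 0 := by
  have hf : Measurable fun x : Fin (m + 2) → ℝ => mergeLastTwo x j :=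
    (measurable_pi_apply j).comp measurable_mergeLastTwo
  have hv (i : ℕ) := h.memLp_comp i (measurable_trialContrast p)
  have hN (i : ℕ) := h.memLp_comp i hf
  simp only [splitContrast_counts, ← counts_mergeLastTwo]
  unfold counts
  rw [covariance_const_mul_left,
    covariance_fun_sum_fun_sum' (fun i _ => hv i) (fun i _ => hN i)]
  refine mul_eq_zero_of_right _ (Finset.sum_eq_zero fun i _ => Finset.sum_eq_zero fun l _ => ?_)
  rcases eq_or_ne i l with rfl | hil
  · rw [covariance_eq_sub (hv i) (hN i), h.integral_trialContrast, zero_mul, sub_zero]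
    refine h.integral_trialContrast_mul i (f := fun x => mergeLastTwo x j) ?_
    simp only [mergeLastTwo_single_castSucc, mergeLastTwo_single_last]
  · exact ((h.indep.indepFun hil).comp (measurable_trialContrast p) hf).covariance_eq_zero
      (hv i) (hN l)

end Contrast

theorem mainTheorem2 {Ω : Type*} [MeasurableSpace Ω] (P : Measure Ω) [IsProbabilityMeasure P] :
    PearsonConverges P 2 ∧
    ∀ k : ℕ, 2 ≤ k →
      (PearsonConverges P k → PearsonConverges P (k + 1)) ∧
      ∀ (p : Fin (k + 1) → ℝ) (X : ℕ → Ω → Fin (k + 1) → ℝ), IsMultinomialSample P p X →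
        -- the merged trials form a `k`-cell sample, whose counts are the merged counts
        IsMultinomialSample P (mergeLastTwo p) (fun i ω => mergeLastTwo (X i ω)) ∧
        (∀ (n : ℕ) (ω : Ω),
          counts (fun i ω => mergeLastTwo (X i ω)) n ω = mergeLastTwo (counts X n ω)) ∧
        -- the decomposition `Q_{k+1} = Q'_k + V²`
        (∀ n : ℕ, 1 ≤ n → ∀ ω : Ω,
          pearsonStat p n (counts X n ω) =
            pearsonStat (mergeLastTwo p) n (mergeLastTwo (counts X n ω)) +
              splitContrast p n (counts X n ω) ^ 2) ∧
        -- `V` is asymptotically standard normal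
        TendstoInDistribution (fun (n : ℕ) (ω : Ω) => splitContrast p n (counts X n ω)) atTop
          (id : ℝ → ℝ) (fun _ => P) (gaussianReal 0 1) ∧
        -- `V` is uncorrelated with every merged count
        (∀ n : ℕ, 1 ≤ n →
          MemLp (fun ω => splitContrast p n (counts X n ω)) 2 P ∧
          ∀ j : Fin k,
            MemLp (fun ω => mergeLastTwo (counts X n ω) j) 2 P ∧
            covariance (fun ω => splitContrast p n (counts X n ω))
              (fun ω => mergeLastTwo (counts X n ω) j) P = 0) := by
  refine ⟨pearsonConverges P 2, fun k hk => ⟨fun _ => pearsonConverges P (k + 1), ?_⟩⟩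
  obtain ⟨m, rfl⟩ : ∃ m, k = m + 1 := ⟨k - 1, by omega⟩
  intro p X h
  refine ⟨h.merge, counts_mergeLastTwo X,
    fun n hn ω => pearsonStat_eq_add_splitContrast_sq h.pos hn _,
    h.tendstoInDistribution_splitContrast,
    fun n _ => ⟨h.memLp_splitContrast n, fun j => ⟨?_, h.covariance_splitContrast n j⟩⟩⟩
  simpa only [counts_mergeLastTwo] using h.merge.memLp_counts n j
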